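/- Let $\Omega \subset \mathbb{R}^d$ be a bounded Lipschitz domain, that is, a nonempty bounded open set which near each of its boundary points is, in suitable Cartesian coordinates, the strict epigraph of a Lipschitz function. Let $\mathrm{BV}(\Omega)$ be the set of all $w \in L^1(\Omega)$ whose distributional gradient is a finite $\mathbb{R}^d$-valued Radon measure $Dw$ on $\Omega$, i.e. $\int_\Omega w\,\nabla\psi\,dx = -\int_\Omega \psi\,dDw$ for all $\psi \in C_c^\infty(\Omega)$; let $|Dw|$ be the variation measure of $Dw$ (with respect to the Euclidean norm) and $\mathrm{TV}(w) = |Dw|(\Omega)$. Let $w \in \mathrm{BV}(\Omega)$ and let $(w_n)_{n\in\mathbb{N}}$ be a sequence in $\mathrm{BV}(\Omega)$ that converges weakly$^*$ to $w$ in $\mathrm{BV}(\Omega)$, that is, $w_n \to w$ in $L^1(\Omega)$ and $\sup_n \mathrm{TV}(w_n) < \infty$. Then \[ \int_\Omega \phi \,d|Dw| \;\le\; \liminf_{n\to\infty} \int_\Omega \phi\,d|Dw_n| \] for every $\phi \in C_0(\Omega)$ with $\phi \ge 0$, where $C_0(\Omega)$ is the space of continuous functions $\Omega \to \mathbb{R}$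 that vanish at the boundary (for every $\varepsilon > 0$ the set $\{|\phi| \ge \varepsilon\}$ is a compact subset of $\Omega$). -/

import Mathlib

open MeasureTheory Filter Topology
open scoped ENNReal NNReal ContDiff ZeroAtInfty InnerProductSpace

/-- `Ω` is a bounded Lipschitz domain of `ℝ^d`: nonempty, open, bounded, and in a neighbourhood `U`
of each boundary point it is the strict epigraph, in some unit direction `ν`, of a Lipschitz
function `γ` of the component `y - ⟪ν, y⟫ ν` orthogonal to `ν`.
Connectedness is not required. -/
structure IsBoundedLipschitzDomain {d : ℕ} (Ω : Set (EuclideanSpace ℝ (Fin d))) : Prop where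
  nonempty : Ω.Nonempty
  isOpen : IsOpen Ω
  isBounded : Bornology.IsBounded Ω
  lipschitz_boundary : ∀ x ∈ frontier Ω, ∃ U ∈ 𝓝 x, ∃ ν : EuclideanSpace ℝ (Fin d), ‖ν‖ = 1 ∧
    ∃ (K : ℝ≥0) (γ : EuclideanSpace ℝ (Fin d) → ℝ), LipschitzWith K γ ∧
      ∀ y ∈ U, (y ∈ Ω ↔ γ (y - ⟪ν, y⟫_ℝ • ν) < ⟪ν, y⟫_ℝ)

/-- The `ℝ^d`-valued Borel measure `μ` on `Ω` is the distributional gradient of `w` on `Ω`: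
`∫_Ω w ∇ψ dx = - ∫_Ω ψ dμ` for all `ψ ∈ C_c^∞(Ω)`. -/
def IsDistribGradient {d : ℕ} (Ω : Set (EuclideanSpace ℝ (Fin d)))
    (w : EuclideanSpace ℝ (Fin d) → ℝ) (μ : VectorMeasure Ω (EuclideanSpace ℝ (Fin d))) : Prop :=
  ∀ ψ : EuclideanSpace ℝ (Fin d) → ℝ, ContDiff ℝ ∞ ψ → HasCompactSupport ψ → tsupport ψ ⊆ Ω →
    ∫ x in Ω, w x • gradient ψ x = - ∫ᵛ x, ψ (x : EuclideanSpace ℝ (Fin d)) ∂•μ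

/-- The space `BV(Ω)`: those `w ∈ L¹(Ω)` whose distributional gradient is a finite
`ℝ^d`-valued Radon measure on `Ω`. -/
def BV {d : ℕ} (Ω : Set (EuclideanSpace ℝ (Fin d))) : Set (Lp ℝ 1 (volume.restrict Ω)) :=
  {w | ∃ μ : VectorMeasure Ω (EuclideanSpace ℝ (Fin d)),
    IsFiniteMeasure μ.variation ∧ IsDistribGradient Ω w μ}

/-- The gradient measure `Dw` of `w ∈ BV(Ω)`. (For open `Ω` it is the only finite measure with
the defining property.) -/
noncomputable def gradMeasure {d : ℕ} {Ω : Set (EuclideanSpace ℝ (Fin d))} (w : BV Ω) :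
    VectorMeasure Ω (EuclideanSpace ℝ (Fin d)) :=
  w.2.choose

theorem gradMeasure_spec {d : ℕ} {Ω : Set (EuclideanSpace ℝ (Fin d))} (w : BV Ω) :
    IsFiniteMeasure (gradMeasure w).variation ∧ IsDistribGradient Ω w.1 (gradMeasure w) :=
  w.2.choose_spec

/-- The variation measure `|Dw|`, with respect to the Euclidean norm on `ℝ^d`. -/
noncomputable def varMeasure {d : ℕ} {Ω : Set (EuclideanSpace ℝ (Fin d))} (w : BV Ω) :
    Measure Ω :=
  (gradMeasure w).variation

/-- The total variation `TV(w) = |Dw|(Ω)`. -/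
noncomputable def totalVar {d : ℕ} {Ω : Set (EuclideanSpace ℝ (Fin d))} (w : BV Ω) : ℝ≥0∞ :=
  varMeasure w Set.univ

/-- Weak* convergence in `BV(Ω)`: convergence in `L¹(Ω)` together with `sup_n TV(w_n) < ∞`. -/
def TendstoWeakStarBV {d : ℕ} {Ω : Set (EuclideanSpace ℝ (Fin d))} (wseq : ℕ → BV Ω)
    (w : BV Ω) : Prop :=
  Tendsto (fun n => (wseq n : Lp ℝ 1 (volume.restrict Ω))) atTop
      (𝓝 (w : Lp ℝ 1 (volume.restrict Ω))) ∧
    ⨆ n, totalVar (wseq n) < ⊤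

/-! Integration by parts turns $L^1$ convergence into $\int\psi\,dDw_n\to\int\psi\,dDw$ for scalar
test functions $\psi$. A cutoff between a compact $K$ and an open $U\supseteq K$ then yields
$|Dw(K)|\le\liminf|Dw_n|(U)$. Disjoint compact sets have disjoint open neighbourhoods, so these
bounds add up by superadditivity of the lower limit, and inner regularity gives
$|Dw|(U)\le\liminf|Dw_n|(U)$ for every open $U$ (`varMeasure_isOpen_le_liminf`). The layer-cake
formula and Fatou's lemma pass from open sets to $\phi\ge 0$. -/

/-- The lower limit of sequences in `ℝ≥0∞` is superadditive. -/
theorem ENNReal.liminf_add_liminf_le (u v : ℕ → ℝ≥0∞) :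
    liminf u atTop + liminf v atTop ≤ liminf (u + v) atTop := by
  have mono (f : ℕ → ℝ≥0∞) : Monotone fun n => ⨅ i ≥ n, f i :=
    fun _ _ hmn => biInf_mono fun _ hi => hmn.trans hi
  simp only [liminf_eq_iSup_iInf_of_nat]
  rw [ENNReal.iSup_add_iSup_of_monotone (mono u) (mono v)]
  exact iSup_mono fun n => le_iInf₂ fun i hi =>
    add_le_add (iInf₂_le i hi) (iInf₂_le i hi)

/-- If open sets bound the vector measure of their compact subsets by the lower limit of a sequence
of measures, then they bound its variation in the same way. -/
theorem variation_isOpen_le_liminf_of_isCompact {X V : Type*} [TopologicalSpace X] [T2Space X]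
    [MeasurableSpace X] [OpensMeasurableSpace X] [NormedAddCommGroup V] (μ : VectorMeasure X V)
    [IsFiniteMeasure μ.variation] [μ.variation.InnerRegularCompactLTTop] (ν : ℕ → Measure X)
    (h : ∀ K U : Set X, IsCompact K → IsOpen U → K ⊆ U →
      ‖μ K‖ₑ ≤ liminf (fun n => ν n U) atTop)
    {U : Set X} (hU : IsOpen U) :
    μ.variation U ≤ liminf (fun n => ν n U) atTop := by
  classical
  -- Induction on `P` with `U` varying: `K q` and the other compacts are separated by open `A` and
  -- `B`, and the induction hypothesis is applied inside `U ∩ B`.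
  have sum_le (P : Finset (Set X)) (K : Set X → Set X) (hK : ∀ p ∈ P, IsCompact (K p))
      (hd : (P : Set (Set X)).PairwiseDisjoint K) (U : Set X) (hU : IsOpen U)
      (hKU : ∀ p ∈ P, K p ⊆ U) : ∑ p ∈ P, ‖μ (K p)‖ₑ ≤ liminf (fun n => ν n U) atTop := by
    induction P using Finset.induction_on generalizing U with
    | empty => simp
    | insert q P hq ih =>
      rw [Finset.coe_insert] at hd
      have hdq : Disjoint (K q) (⋃ p ∈ P, K p) := by
        rw [Set.disjoint_iUnion₂_right]
        exact fun p hp => hd (Set.mem_insert _ _) (Set.mem_insert_of_mem _ hp)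
          (ne_of_mem_of_not_mem hp hq).symm
      obtain ⟨A, B, hA, hB, hKA, hKB, hAB⟩ := SeparatedNhds.of_isCompact_isCompact
        (hK q (Finset.mem_insert_self _ _))
        (P.isCompact_biUnion fun p hp => hK p (Finset.mem_insert_of_mem hp)) hdq
      rw [Finset.sum_insert hq]
      calc ‖μ (K q)‖ₑ + ∑ p ∈ P, ‖μ (K p)‖ₑ
          ≤ liminf (fun n => ν n (U ∩ A)) atTop + liminf (fun n => ν n (U ∩ B)) atTop := by
            refine add_le_add (h _ _ (hK q (Finset.mem_insert_self _ _)) (hU.inter hA)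
              (Set.subset_inter (hKU q (Finset.mem_insert_self _ _)) hKA)) ?_
            exact ih (fun p hp => hK p (Finset.mem_insert_of_mem hp))
              (hd.subset (Set.subset_insert _ _)) _ (hU.inter hB)
              fun p hp => Set.subset_inter (hKU p (Finset.mem_insert_of_mem hp))
                ((Set.subset_biUnion_of_mem (u := K) hp).trans hKB)
        _ ≤ liminf ((fun n => ν n (U ∩ A)) + fun n => ν n (U ∩ B)) atTop :=
            ENNReal.liminf_add_liminf_le _ _
        _ ≤ liminf (fun n => ν n U) atTop := by
            refine liminf_le_liminf (Eventually.of_forall fun n => ?_)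
            rw [Pi.add_apply, ← measure_union (hAB.mono Set.inter_subset_right
              Set.inter_subset_right) (hU.inter hB).measurableSet]
            exact measure_mono (Set.union_subset Set.inter_subset_left Set.inter_subset_left)
  refine le_of_forall_lt fun a ha => ?_
  obtain ⟨P, hPU, hPd, hPm, hPa⟩ := μ.exists_lt_sum_of_lt_variation hU.measurableSet ha
  refine hPa.trans_le (ENNReal.le_of_forall_pos_le_add fun ε hε _ => ?_)
  -- The `+ 1` avoids division by zero when `P` is empty.
  have hδ : (ε / (P.card + 1) : ℝ≥0∞) ≠ 0 :=
    (ENNReal.div_pos (by simpa using hε.ne') (by finiteness)).ne'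
  have hK (p : Set X) (hp : p ∈ P) : ∃ K ⊆ p, IsCompact K ∧
      μ.variation (p \ K) < ε / (P.card + 1) :=
    (hPm p hp).exists_isCompact_sdiff_lt (measure_ne_top _ _) hδ
  choose! K hKp hKc hKε using hK
  calc ∑ p ∈ P, ‖μ p‖ₑ
      ≤ ∑ p ∈ P, (‖μ (K p)‖ₑ + ε / (P.card + 1)) := by
        refine Finset.sum_le_sum fun p hp => ?_
        rw [← VectorMeasure.of_add_of_sdiff (hKc p hp).measurableSet (hPm p hp) (hKp p hp)]
        exact (enorm_add_le _ _).trans (add_le_add le_rfl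
          ((VectorMeasure.enorm_measure_le_variation _ _).trans (hKε p hp).le))
    _ = ∑ p ∈ P, ‖μ (K p)‖ₑ + P.card * (ε / (P.card + 1)) := by
        rw [Finset.sum_add_distrib, Finset.sum_const, nsmul_eq_mul]
    _ ≤ liminf (fun n => ν n U) atTop + ε := by
        refine add_le_add (sum_le P K hKc (fun p hp q hq hpq =>
          (hPd hp hq hpq).mono (hKp p hp) (hKp q hq)) U hU
          fun p hp => (hKp p hp).trans (hPU p hp)) ?_
        calc (P.card : ℝ≥0∞) * (ε / (P.card + 1))
            ≤ (P.card + 1) * (ε / (P.card + 1)) := by gcongr; exact le_self_add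
          _ = ε := ENNReal.mul_div_cancel (by simp) (by finiteness)

/-- The integral of a function close to the indicator of `K` is close to the measure of `K`. -/
theorem enorm_le_enorm_integral_add_variation {X V : Type*} [MeasurableSpace X]
    [NormedAddCommGroup V] [NormedSpace ℝ V] [CompleteSpace V] (μ : VectorMeasure X V)
    [IsFiniteMeasure μ.variation] {K U : Set X} (hK : MeasurableSet K) (hU : MeasurableSet U)
    {f : X → ℝ} (hf : Measurable f) (hf1 : ∀ x, ‖f x‖ₑ ≤ 1) (hfK : ∀ x ∈ K, f x = 1)
    (hfU : ∀ x ∉ U, f x = 0) :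
    ‖μ K‖ₑ ≤ ‖∫ᵛ x, f x ∂•μ‖ₑ + μ.variation (U \ K) := by
  have hfi : μ.Integrable f :=
    Integrable.of_bound hf.aestronglyMeasurable 1 (Eventually.of_forall fun x => by
      simpa only [← ofReal_norm, ENNReal.ofReal_le_one] using hf1 x)
  have hKi : μ.Integrable (K.indicator fun _ => (1 : ℝ)) :=
    (integrable_const (μ := μ.variation) (1 : ℝ)).indicator hK
  have hKval : ∫ᵛ x, K.indicator (fun _ => (1 : ℝ)) x ∂•μ = μ K := by
    rw [VectorMeasure.integral_indicator hK, VectorMeasure.integral_const]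
    simp [VectorMeasure.restrict_apply, hK]
  have hdiff : ‖(∫ᵛ x, K.indicator (fun _ => (1 : ℝ)) x ∂•μ) - ∫ᵛ x, f x ∂•μ‖ₑ ≤
      μ.variation (U \ K) := by
    rw [← VectorMeasure.integral_fun_sub hKi hfi]
    -- The two integrands differ only on `U \ K`, and there by at most one.
    calc _ ≤ ‖ContinuousLinearMap.lsmul ℝ ℝ‖ₑ *
          ∫⁻ x, ‖K.indicator (fun _ => (1 : ℝ)) x - f x‖ₑ ∂μ.variation :=
        VectorMeasure.enorm_integral_le_lintegral_enorm
      _ ≤ 1 * ∫⁻ x, (U \ K).indicator 1 x ∂μ.variation := by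
        gcongr with x
        · rw [← ofReal_norm, ENNReal.ofReal_le_one]
          exact ContinuousLinearMap.opNorm_lsmul_le
        · by_cases hxK : x ∈ K
          · simp [hxK, hfK x hxK]
          · by_cases hxU : x ∈ U
            · simpa [hxK, hxU] using hf1 x
            · simp [hxK, hxU, hfU x hxU]
      _ = μ.variation (U \ K) := by
        rw [one_mul, lintegral_indicator_one (hU.diff hK)]
  rw [← hKval]
  calc _ = ‖(∫ᵛ x, f x ∂•μ) + ((∫ᵛ x, K.indicator (fun _ => (1 : ℝ)) x ∂•μ) -
        ∫ᵛ x, f x ∂•μ)‖ₑ := by rw [add_sub_cancel]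
    _ ≤ _ := (enorm_add_le _ _).trans (by gcongr)

/-- A function bounded by one and vanishing outside `U` has an integral bounded by the variation
of `U`. -/
theorem enorm_integral_le_variation {X V : Type*} [MeasurableSpace X]
    [NormedAddCommGroup V] [NormedSpace ℝ V] (μ : VectorMeasure X V) {U : Set X}
    (hU : MeasurableSet U) {f : X → ℝ} (hf1 : ∀ x, ‖f x‖ₑ ≤ 1) (hfU : ∀ x ∉ U, f x = 0) :
    ‖∫ᵛ x, f x ∂•μ‖ₑ ≤ μ.variation U := by
  calc _ ≤ ‖ContinuousLinearMap.lsmul ℝ ℝ‖ₑ * ∫⁻ x, ‖f x‖ₑ ∂μ.variation :=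
        VectorMeasure.enorm_integral_le_lintegral_enorm
    _ ≤ 1 * ∫⁻ x, U.indicator 1 x ∂μ.variation := by
      gcongr with x
      · rw [← ofReal_norm, ENNReal.ofReal_le_one]
        exact ContinuousLinearMap.opNorm_lsmul_le
      · by_cases hxU : x ∈ U
        · simpa [hxU] using hf1 x
        · simp [hfU x hxU]
    _ = μ.variation U := by rw [one_mul, lintegral_indicator_one hU]

/-- A smooth cutoff function between a compact set and an open neighbourhood of it. -/
theorem exists_contDiff_one_on_tsupport_subset {E : Type*} [NormedAddCommGroup E]
    [NormedSpace ℝ E] [FiniteDimensional ℝ E] {K U : Set E} (hK : IsCompact K) (hU : IsOpen U)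
    (hKU : K ⊆ U) :
    ∃ ψ : E → ℝ, ContDiff ℝ ∞ ψ ∧ HasCompactSupport ψ ∧ tsupport ψ ⊆ U ∧
      (∀ x ∈ K, ψ x = 1) ∧ ∀ x, ψ x ∈ Set.Icc (0 : ℝ) 1 := by
  have := FiniteDimensional.proper ℝ E
  obtain ⟨L, hL, hKL, hLU⟩ := exists_compact_between hK hU hKU
  obtain ⟨f, hf1, hf0, hf⟩ := exists_contMDiffMap_one_nhds_of_subset_interior (n := (⊤ : ℕ∞))
    (modelWithCornersSelf ℝ E) hK.isClosed hKL
  have hsupp : tsupport f ⊆ L :=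
    closure_minimal (fun x hx => by_contra fun hxL => hx (hf0 x hxL)) hL.isClosed
  exact ⟨f, f.contMDiff.contDiff, hL.of_isClosed_subset (isClosed_tsupport _) hsupp,
    hsupp.trans hLU, fun x hx => hf1.self_of_nhdsSet x hx, hf⟩

/-- Convergence in `L¹` implies convergence of the integrals against a bounded function. -/
theorem tendsto_integral_smul_of_tendsto_Lp_one {X V : Type*} [MeasurableSpace X]
    {μ : Measure X} [NormedAddCommGroup V] [NormedSpace ℝ V] {w : ℕ → Lp ℝ 1 μ} {w₀ : Lp ℝ 1 μ}
    (hw : Tendsto w atTop (𝓝 w₀)) {g : X → V} (hg : AEStronglyMeasurable g μ) {C : ℝ≥0}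
    (hC : ∀ x, ‖g x‖ₑ ≤ C) :
    Tendsto (fun n => ∫ x, w n x • g x ∂μ) atTop (𝓝 (∫ x, w₀ x • g x ∂μ)) := by
  have hint (v : Lp ℝ 1 μ) : Integrable (fun x => v x • g x) μ :=
    (L1.integrable_coeFn v).smul_bdd (C : ℝ) hg
      (Eventually.of_forall fun x => by simpa [enorm_le_coe] using! hC x)
  refine tendsto_integral_of_L1 _ (hint w₀).aestronglyMeasurable
    (Eventually.of_forall fun n => hint (w n)) ?_
  have hlim : Tendsto (fun n => eLpNorm (w n - w₀ : X → ℝ) 1 μ * C) atTop (𝓝 0) := by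
    have := ENNReal.Tendsto.mul_const (b := (C : ℝ≥0∞))
      ((Lp.tendsto_Lp_iff_tendsto_eLpNorm' w w₀).1 hw) (Or.inr ENNReal.coe_ne_top)
    simpa using this
  refine tendsto_of_tendsto_of_tendsto_of_le_of_le tendsto_const_nhds hlim
    (fun _ => zero_le) fun n => ?_
  dsimp only
  rw [eLpNorm_one_eq_lintegral_enorm, ← lintegral_mul_const' _ _ ENNReal.coe_ne_top]
  refine lintegral_mono fun x => ?_
  rw [← sub_smul, enorm_smul, Pi.sub_apply]
  gcongr
  exact hC x

/-- The gradient of a test function is continuous with compact support, hence bounded, so it can be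
paired with an $L^1$ limit. -/
theorem tendsto_integral_gradMeasure {d : ℕ} {Ω : Set (EuclideanSpace ℝ (Fin d))}
    {wseq : ℕ → BV Ω} {w : BV Ω}
    (hw : Tendsto (fun n => (wseq n : Lp ℝ 1 (volume.restrict Ω))) atTop
      (𝓝 (w : Lp ℝ 1 (volume.restrict Ω))))
    {ψ : EuclideanSpace ℝ (Fin d) → ℝ} (hψ : ContDiff ℝ ∞ ψ) (hψc : HasCompactSupport ψ)
    (hψΩ : tsupport ψ ⊆ Ω) :
    Tendsto (fun n => ∫ᵛ x, ψ (x : EuclideanSpace ℝ (Fin d)) ∂•(gradMeasure (wseq n))) atTop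
      (𝓝 (∫ᵛ x, ψ (x : EuclideanSpace ℝ (Fin d)) ∂•(gradMeasure w))) := by
  have hcont : Continuous (gradient ψ) :=
    (InnerProductSpace.toDual ℝ _).symm.continuous.comp (hψ.continuous_fderiv (by simp))
  have hsupp : HasCompactSupport (gradient ψ) :=
    (hψc.fderiv (𝕜 := ℝ)).comp_left (map_zero _)
  obtain ⟨C, hC⟩ := hsupp.exists_bound_of_continuous hcont
  have hbound : ∀ x, ‖gradient ψ x‖ₑ ≤ (C.toNNReal : ℝ≥0∞) := fun x => by
    rw [← ofReal_norm]
    exact ENNReal.ofReal_le_ofReal (hC x)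
  have hlim := (tendsto_integral_smul_of_tendsto_Lp_one hw hcont.aestronglyMeasurable hbound).neg
  have heq (v : BV Ω) : ∫ᵛ x, ψ (x : EuclideanSpace ℝ (Fin d)) ∂•(gradMeasure v) =
      -∫ x in Ω, (v : Lp ℝ 1 (volume.restrict Ω)) x • gradient ψ x := by
    rw [(gradMeasure_spec v).2 ψ hψ hψc hψΩ, neg_neg]
  simpa only [heq] using hlim

instance {d : ℕ} {Ω : Set (EuclideanSpace ℝ (Fin d))} (w : BV Ω) :
    IsFiniteMeasure (gradMeasure w).variation :=
  (gradMeasure_spec w).1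

instance {d : ℕ} {Ω : Set (EuclideanSpace ℝ (Fin d))} (w : BV Ω) :
    IsFiniteMeasure (varMeasure w) :=
  (gradMeasure_spec w).1

/-- The variation measure of an open set is lower semicontinuous under `L¹` convergence. -/
theorem varMeasure_isOpen_le_liminf {d : ℕ} {Ω : Set (EuclideanSpace ℝ (Fin d))}
    (hΩ : IsOpen Ω) {wseq : ℕ → BV Ω} {w : BV Ω}
    (hw : Tendsto (fun n => (wseq n : Lp ℝ 1 (volume.restrict Ω))) atTop
      (𝓝 (w : Lp ℝ 1 (volume.restrict Ω))))
    {U : Set Ω} (hU : IsOpen U) :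
    varMeasure w U ≤ liminf (fun n => varMeasure (wseq n) U) atTop := by
  have : LocallyCompactSpace Ω := hΩ.locallyCompactSpace
  refine variation_isOpen_le_liminf_of_isCompact (gradMeasure w) (fun n => varMeasure (wseq n))
    (fun K U hK hU hKU => ENNReal.le_of_forall_pos_le_add fun ε hε _ => ?_) hU
  -- The cutoff will live in `U ∩ V`: `V` makes the error on `V \ K` small for the limit, while `U`
  -- bounds the integrals along the sequence.
  obtain ⟨V, hKV, hV, -, hVK⟩ := hK.measurableSet.exists_isOpen_sdiff_lt
    (μ := (gradMeasure w).variation) (measure_ne_top _ _)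
    (ε := (ε : ℝ≥0∞)) (by simpa using hε.ne')
  obtain ⟨ψ, hψ, hψc, hψU, hψK, hψI⟩ := exists_contDiff_one_on_tsupport_subset
    (hK.image continuous_subtype_val)
    (hΩ.isOpenMap_subtype_val _ (hU.inter hV)) (Set.image_mono (Set.subset_inter hKU hKV))
  have hψ1 (x : Ω) : ‖ψ x‖ₑ ≤ 1 := by
    rw [Real.enorm_of_nonneg (hψI x).1, ENNReal.ofReal_le_one]
    exact (hψI x).2
  have hψ0 (x : Ω) (hx : x ∉ U ∩ V) : ψ x = 0 :=
    image_eq_zero_of_notMem_tsupport fun hxs =>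
      hx ((Subtype.val_injective.mem_set_image).1 (hψU hxs))
  have hlim := (tendsto_integral_gradMeasure hw hψ hψc
    (hψU.trans (Subtype.coe_image_subset _ _))).enorm
  calc ‖gradMeasure w K‖ₑ
      ≤ ‖∫ᵛ x, ψ (x : EuclideanSpace ℝ (Fin d)) ∂•(gradMeasure w)‖ₑ +
          (gradMeasure w).variation (V \ K) :=
        enorm_le_enorm_integral_add_variation _ hK.measurableSet hV.measurableSet
          (hψ.continuous.comp continuous_subtype_val).measurable hψ1
          (fun x hx => hψK x (Set.mem_image_of_mem _ hx)) fun x hx => hψ0 x fun h => hx h.2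
    _ ≤ liminf (fun n => varMeasure (wseq n) U) atTop + ε := by
        refine add_le_add ?_ hVK.le
        rw [← hlim.liminf_eq]
        exact liminf_le_liminf (Eventually.of_forall fun n =>
          enorm_integral_le_variation _ hU.measurableSet hψ1 fun x hx => hψ0 x fun h => hx h.1)

theorem mainTheorem5 {d : ℕ} {Ω : Set (EuclideanSpace ℝ (Fin d))}
    (hΩ : IsBoundedLipschitzDomain Ω) (wseq : ℕ → BV Ω) (w : BV Ω)
    (hw : TendstoWeakStarBV wseq w) (φ : C₀(Ω, ℝ)) (hφ : ∀ x, 0 ≤ φ x) :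
    ((∫ x, φ x ∂(varMeasure w) : ℝ) : EReal) ≤
      liminf (fun n => ((∫ x, φ x ∂(varMeasure (wseq n)) : ℝ) : EReal)) atTop := by
  have hlint := lintegral_le_liminf_lintegral_of_forall_isOpen_measure_le_liminf_measure
    (μ := varMeasure w) (μs := fun n => varMeasure (wseq n)) (f := φ) (map_continuous φ) hφ
    fun G hG => varMeasure_isOpen_le_liminf hΩ.isOpen hw.1 hG
  have hcoe (v : BV Ω) : ((∫ x, φ x ∂(varMeasure v) : ℝ) : EReal) =
      ((∫⁻ x, ENNReal.ofReal (φ x) ∂(varMeasure v) : ℝ≥0∞) : EReal) := by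
    -- `φ` is bounded and the measure finite, so the real integral is not the default value zero.
    have hint : Integrable φ (varMeasure v) :=
      BoundedContinuousFunction.integrable _ φ.toBCF
    rw [← ofReal_integral_eq_lintegral_ofReal hint (Eventually.of_forall hφ),
      EReal.coe_ennreal_ofReal, max_eq_left (integral_nonneg hφ)]
  simp only [hcoe]
  -- The lower limit is taken in `EReal`, the known bound in `ℝ≥0∞`; they are compared through the
  -- levels `a` below the left side, negative ones being trivial.
  rw [le_liminf_iff]
  intro a ha
  rcases lt_or_ge a 0 with ha0 | ha0
  · exact Eventually.of_forall fun n => ha0.trans_le (EReal.coe_ennreal_nonneg _)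
  · lift a to ℝ≥0∞ using ha0
    rw [EReal.coe_ennreal_lt_coe_ennreal_iff] at ha
    filter_upwards [eventually_lt_of_lt_liminf (ha.trans_le hlint)] with n hn
    exact EReal.coe_ennreal_lt_coe_ennreal_iff.2 hn
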